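/- Let $0\le p\le \tfrac12$. For a random variable $X$ on a finite alphabet of size $N$, an order function of $X$ numbers the symbols $1,\dots,N$ in descending order of probability (ties broken arbitrarily), and for a pair $(X,Y)$ the conditional guessing time is $\mathsf G(X\mid Y)=\mathbb E\big[\mathsf{ORD}_{X\mid Y}(X\mid Y)\big]$, where $\mathsf{ORD}_{X\mid Y}(\cdot\mid y)$ is an order function of $P_{X\mid Y}(\cdot\mid y)$. One of $M=\lceil 2^{nR}\rceil$ equiprobable messages $W$ is sent over $n$ uses of the binary symmetric channel with crossover probability $p$ and noiseless feedback: the $k$-th input $X_k\in\{0,1\}$ is a function of $W$ and of the past outputs $Y^{k-1}$. In the repeated zigzag scheme, $X_k$ is the indicator that $W$ has an odd index with respect to an order function of its current posterior distribution given $Y^{k-1}$. The cutoff rate with feedback $R_{\mathrm{cutoff,fb}}(p)$ is the supremum of all rates $R$ for which there are feedback coding schemes whose guessing time $\mathsf G(W\mid Y^n)$ is sub-exponential in $n$, i.e. $\frac1n\log_2\mathsf G(W\mid Y^n)\to0$. Theorem. For every rate $R<R_{\mathrm{cutoff,fb}}(p)$ the repeated zigzag scheme has guessing time $\mathsf G(W\mid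 Y^n)=O(n^2)$; that is, there is a constant $C$ depending only on $p$ and $R$ such that $\mathsf G(W\mid Y^n)\le C n^2$ for all $n\ge1$, however the ties between equally likely messages are broken. Moreover the supremum defining $R_{\mathrm{cutoff,fb}}(p)$ is finite and $R_{\mathrm{cutoff,fb}}(p)=1-h_{1/2}(p)$, where $h_{1/2}(p)=2\log_2\!\big(\sqrt p+\sqrt{1-p}\big)$. Hence the repeated zigzag scheme has guessing time $O(n^2)$ at every rate $R<1-h_{1/2}(p)$ and achieves the cutoff rate with feedback. -/

import Mathlib

open Filter Topology

noncomputable section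

namespace ZigzagGuessing

/-- `ord` is an order function of the distribution `P` on a finite alphabet: it numbers the symbols
`1, …, N` in descending order of probability. It is unique up to the order of equally likely
symbols. -/
def IsOrderFunction {α : Type*} [Fintype α] (P : α → ℝ) (ord : α → ℕ) : Prop :=
  Set.BijOn ord Set.univ (Set.Icc 1 (Fintype.card α)) ∧
    ∀ x x' : α, P x' < P x → ord x < ord x'

open Classical in
/-- The order function that breaks ties by the order of the alphabet. (The guessing time does not
depend on the way ties are broken.) -/
def orderIndex {α : Type*} [Fintype α] [LinearOrder α] (P : α → ℝ) (x : α) : ℕ :=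
  (Finset.univ.filter fun x' : α => P x < P x' ∨ (P x' = P x ∧ x' ≤ x)).card

theorem isOrderFunction_orderIndex {α : Type*} [Fintype α] [LinearOrder α] (P : α → ℝ) :
    IsOrderFunction P (orderIndex P) := by
  classical
  have lt_of : ∀ x x' : α, (P x' < P x ∨ (P x = P x' ∧ x < x')) →
      orderIndex P x < orderIndex P x' := by
    intro x x' h
    unfold orderIndex
    apply Finset.card_lt_card
    rw [Finset.ssubset_iff_of_subset]
    · refine ⟨x', by simp, ?_⟩
      simp only [Finset.mem_filter, Finset.mem_univ, true_and, not_or, not_lt, not_and, not_le]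
      rcases h with h | ⟨h, h2⟩
      · exact ⟨h.le, fun h' => absurd h' h.ne⟩
      · exact ⟨h.ge, fun _ => h2⟩
    · intro z
      simp only [Finset.mem_filter, Finset.mem_univ, true_and]
      rintro (hz | ⟨hz, hz2⟩)
      · rcases h with h | ⟨h, _⟩
        · exact Or.inl (h.trans hz)
        · exact Or.inl (h ▸ hz)
      · rcases h with h | ⟨h, h2⟩
        · exact Or.inl (hz ▸ h)
        · exact Or.inr ⟨hz.trans h, hz2.trans h2.le⟩
  have inj : Function.Injective (orderIndex P) := by
    intro x x' h
    by_contra hne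
    rcases lt_trichotomy (P x) (P x') with h1 | h1 | h1
    · exact absurd h (lt_of x' x (Or.inl h1)).ne'
    · rcases lt_or_gt_of_ne hne with h2 | h2
      · exact absurd h (lt_of x x' (Or.inr ⟨h1, h2⟩)).ne
      · exact absurd h (lt_of x' x (Or.inr ⟨h1.symm, h2⟩)).ne'
    · exact absurd h (lt_of x x' (Or.inl h1)).ne
  have maps : ∀ x, orderIndex P x ∈ Finset.Icc 1 (Fintype.card α) := by
    intro x
    rw [Finset.mem_Icc]
    refine ⟨Finset.card_pos.2 ⟨x, by simp⟩, Finset.card_le_univ _⟩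
  refine ⟨⟨fun x _ => by simpa using maps x, inj.injOn, ?_⟩, fun x x' h => lt_of x x' (Or.inl h)⟩
  have himg : Finset.univ.image (orderIndex P) = Finset.Icc 1 (Fintype.card α) := by
    apply Finset.eq_of_subset_of_card_le
    · intro k hk
      obtain ⟨x, -, rfl⟩ := Finset.mem_image.1 hk
      exact maps x
    · rw [Finset.card_image_of_injective _ inj]; simp
  intro k hk
  have hk' : k ∈ Finset.univ.image (orderIndex P) := by
    rw [himg]; simpa using hk
  obtain ⟨x, -, hx⟩ := Finset.mem_image.1 hk'
  exact ⟨x, trivial, hx⟩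

/-- The conditional distribution `P(· ∣ y)` of `X` given `Y = y`, for a joint distribution `J`. -/
def conditional {α β : Type*} [Fintype α] (J : α → β → ℝ) (y : β) : α → ℝ :=
  fun x => J x y / ∑ x', J x' y

/-- The conditional guessing time `G(X ∣ Y) = E[ORD_{X∣Y}(X ∣ Y)]` of a joint distribution `J`
of `(X, Y)`. -/
def condGuessingTime {α β : Type*} [Fintype α] [LinearOrder α] [Fintype β]
    (J : α → β → ℝ) : ℝ :=
  ∑ y, ∑ x, J x y * (orderIndex (conditional J y) x : ℝ)

/-- The zigzag partition: `A` consists of the symbols of odd index with respect to some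
order function of `P` (ties may be broken in any way). -/
def IsZigzagPartition {α : Type*} [Fintype α] (P : α → ℝ) (A : Set α) : Prop :=
  ∃ ord : α → ℕ, IsOrderFunction P ord ∧ A = {x | Odd (ord x)}

/-- Transition probabilities of the binary symmetric channel with crossover probability `p`:
input `x`, output `y`. -/
def bsc (p : ℝ) (x y : Bool) : ℝ := if y = x then 1 - p else p

/-- A feedback encoder for `M` messages: the channel input at time `k` (counted from `0`) is a
function of the `k` previous channel outputs and of the message. -/
abbrev FeedbackEncoder (M : ℕ) := (k : ℕ) → (Fin k → Bool) → Fin M → Bool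

/-- `P(Yⁿ = y ∣ W = w)` for `n` uses of the BSC with noiseless feedback. -/
def likelihood (p : ℝ) {M : ℕ} (enc : FeedbackEncoder M) (n : ℕ) (w : Fin M)
    (y : Fin n → Bool) : ℝ :=
  ∏ k : Fin n, bsc p (enc k (fun i : Fin k => y (Fin.castLE k.isLt.le i)) w) (y k)

/-- The joint distribution of the uniform message `W` and the channel outputs `Yⁿ`. -/
def jointLaw (p : ℝ) {M : ℕ} (enc : FeedbackEncoder M) (n : ℕ) (w : Fin M)
    (y : Fin n → Bool) : ℝ :=
  1 / (M : ℝ) * likelihood p enc n w y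

/-- `G(W ∣ Yⁿ)` for the given feedback encoder. -/
def messageGuessingTime (p : ℝ) {M : ℕ} (enc : FeedbackEncoder M) (n : ℕ) : ℝ :=
  condGuessingTime (jointLaw p enc n)

/-- The repeated zigzag scheme over `n` channel uses: at every step the channel input is the
indicator of the zigzag partition of the current posterior distribution of the message. -/
def IsZigzagScheme (p : ℝ) {M : ℕ} (enc : FeedbackEncoder M) (n : ℕ) : Prop :=
  ∀ k < n, ∀ y : Fin k → Bool,
    IsZigzagPartition (conditional (jointLaw p enc k) y) {w | enc k y w = true}

/-- The number of messages at rate `R` and block length `n`: `2^{nR}`, rounded up. -/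
def numMessages (R : ℝ) (n : ℕ) : ℕ := ⌈(2 : ℝ) ^ ((n : ℝ) * R)⌉₊

/-- The rates at which some sequence of feedback coding schemes has a guessing time that is
sub-exponential in `n`. (The guessing time is always at least `1`.) -/
def subexponentialRates (p : ℝ) : Set ℝ :=
  {R | ∃ enc : (n : ℕ) → FeedbackEncoder (numMessages R n),
    Tendsto (fun n : ℕ => Real.logb 2 (messageGuessingTime p (enc n) n) / (n : ℝ)) atTop (𝓝 0)}

/-- The cutoff rate with feedback of the BSC. -/
def cutoffRateFb (p : ℝ) : ℝ := sSup (subexponentialRates p)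

/-- The binary Rényi entropy of order `1/2`, in bits. -/
def renyiHalf (p : ℝ) : ℝ := 2 * Real.logb 2 (√p + √(1 - p))

/-- The likelihoods generated by the zigzag scheme that breaks ties by the message index. -/
def zigzagLikelihood (p : ℝ) (M : ℕ) : (k : ℕ) → (Fin k → Bool) → Fin M → ℝ
  | 0, _, _ => 1
  | k + 1, y, w =>
      let L := zigzagLikelihood p M k (fun i => y i.castSucc)
      L w * bsc p (decide (Odd (orderIndex
        (fun w => (1 / (M : ℝ) * L w) / ∑ w', 1 / (M : ℝ) * L w') w))) (y (Fin.last k))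

/-- The repeated zigzag scheme exists. -/
theorem exists_isZigzagScheme (p : ℝ) (M : ℕ) :
    ∃ enc : FeedbackEncoder M, ∀ n, IsZigzagScheme p enc n := by
  let enc : FeedbackEncoder M := fun k y w => decide (Odd (orderIndex
    (fun w => (1 / (M : ℝ) * zigzagLikelihood p M k y w) /
      ∑ w', 1 / (M : ℝ) * zigzagLikelihood p M k y w') w))
  have key : ∀ (k : ℕ) (y : Fin k → Bool) (w : Fin M),
      likelihood p enc k w y = zigzagLikelihood p M k y w := by
    intro k
    induction k with
    | zero => intro y w; simp [likelihood, zigzagLikelihood]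
    | succ k ih =>
      intro y w
      rw [zigzagLikelihood, ← ih, likelihood, Fin.prod_univ_castSucc]
      rfl
  refine ⟨enc, fun n k _ y => ⟨_, isOrderFunction_orderIndex _, ?_⟩⟩
  ext w
  simp only [Set.mem_ofPred_eq, enc, decide_eq_true_eq]
  have : conditional (jointLaw p enc k) y = fun w => (1 / (M : ℝ) * zigzagLikelihood p M k y w) /
      ∑ w', 1 / (M : ℝ) * zigzagLikelihood p M k y w' := by
    funext w
    simp only [conditional, jointLaw, key]
  rw [this]

end ZigzagGuessing

end

open Filter Topology

namespace ZigzagGuessing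

/-! ### Order functions and alternating sums -/

section OrderFunctions

variable {α : Type*} [Fintype α]

/-! Everything is controlled by `renyiSum`, S_n = Σ_y (Σ_w √P(w,y))². By Arikan's bounds it
dominates the guessing time and exceeds it by at most the factor 1 + log M (`condGuessingTime_le`,
`sum_sq_le_condGuessingTime`).

Let a, b be the √P-weights of the two input cells after output y, and ρ = `renyiFactor p` =
2^(h_{1/2}(p) - 1) ≤ 1. One channel use replaces (a+b)² by ρ(a+b)² + (1-ρ)(a-b)² (`renyiSum_succ`).
Dropping the last term gives S_n ≥ ρ^n M for every encoder, hence the converse. Under zigzag, (a-b)²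
is at most the largest P(w,y), so these terms sum to at most 1 over y. Then S_{n+1} ≤ ρ S_n + (1-ρ),
so S_n ≤ ρ^n M + 1, which is bounded for R < 1 - h_{1/2}(p). The O(n²) claim thus holds with a
constant bound. -/

theorem IsOrderFunction.apply_le_apply {P : α → ℝ} {ord : α → ℕ} (h : IsOrderFunction P ord)
    {x x' : α} (hx : ord x ≤ ord x') : P x' ≤ P x := by
  by_contra hlt
  exact absurd (h.2 x' x (not_le.1 hlt)) (not_lt.2 hx)

theorem IsOrderFunction.sum_comp {P : α → ℝ} {ord : α → ℕ} (h : IsOrderFunction P ord)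
    (f : ℕ → ℝ) : ∑ x, f (ord x) = ∑ i ∈ Finset.range (Fintype.card α), f (i + 1) := by
  have himg : Finset.univ.image ord = Finset.Icc 1 (Fintype.card α) := by
    ext k
    have := Set.ext_iff.1 h.1.image_eq k
    simpa using this
  rw [← Finset.sum_image (f := f) (s := Finset.univ) (g := ord)
    (fun x _ y _ hxy => h.1.injOn trivial trivial hxy), himg, Finset.range_eq_Ico,
    Finset.sum_Ico_add' f 0 (Fintype.card α) 1]
  rfl

theorem IsOrderFunction.of_div {P : α → ℝ} {ord : α → ℕ} {c : ℝ} (hc : 0 < c)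
    (h : IsOrderFunction (fun x => P x / c) ord) : IsOrderFunction P ord :=
  ⟨h.1, fun x x' hx => h.2 x x' (div_lt_div_of_pos_right hx hc)⟩

theorem IsOrderFunction.sqrt {P : α → ℝ} {ord : α → ℕ} (hP : ∀ x, 0 ≤ P x)
    (h : IsOrderFunction P ord) : IsOrderFunction (fun x => √(P x)) ord :=
  ⟨h.1, fun x x' hx => h.2 x x' ((Real.sqrt_lt_sqrt_iff (hP x')).1 hx)⟩

/-- Peeling off the first term leaves g 0 minus an alternating sum of the shifted sequence, which
lies between 0 and g 1 ≤ g 0. -/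
theorem alternating_sum_mem_Icc (M : ℕ) : ∀ g : ℕ → ℝ, Antitone g → (∀ i, 0 ≤ g i) →
    ∑ i ∈ Finset.range M, (-1) ^ i * g i ∈ Set.Icc 0 (g 0) := by
  induction M with
  | zero => intro g _ h0; simpa using h0 0
  | succ M ih =>
    intro g hg h0
    have := ih (fun i => g (i + 1)) (fun i j hij => hg (by omega)) (fun i => h0 _)
    rw [Finset.sum_range_succ']
    have h2 : ∑ i ∈ Finset.range M, (-1 : ℝ) ^ (i + 1) * g (i + 1) =
        -∑ i ∈ Finset.range M, (-1 : ℝ) ^ i * g (i + 1) := by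
      rw [← Finset.sum_neg_distrib]
      exact Finset.sum_congr rfl fun i _ => by ring
    rw [h2]
    have h01 := hg (Nat.zero_le 1)
    simp only [zero_add] at this
    constructor <;> simp <;> linarith [this.1, this.2]

/-- The two cells of a zigzag partition differ in weight by at most the largest weight. -/
theorem IsOrderFunction.exists_zigzag_diff [Nonempty α] {r : α → ℝ} {ord : α → ℕ}
    (h : IsOrderFunction r ord) (hr : ∀ x, 0 ≤ r x) :
    ∃ x₀, ∑ x, (if Odd (ord x) then r x else -r x) ∈ Set.Icc 0 (r x₀) := by
  classical
  have hsurj : ∀ i < Fintype.card α, ∃ x, ord x = i + 1 := fun i hi => by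
    obtain ⟨x, -, hx⟩ := h.1.surjOn (show i + 1 ∈ Set.Icc 1 (Fintype.card α) from ⟨by omega, hi⟩)
    exact ⟨x, hx⟩
  have hlt : ∀ x i, ord x = i + 1 → i < Fintype.card α := fun x i hx => by
    have := (h.1.mapsTo (Set.mem_univ x)).2
    omega
  -- The weights in descending order, reindexed from 0; the default 0 past the alphabet keeps `g`
  -- antitone and nonnegative.
  let g : ℕ → ℝ := fun i => if hi : ∃ x, ord x = i + 1 then r hi.choose else 0
  have hg : ∀ x i, ord x = i + 1 → g i = r x := fun x i hx => by
    have hi : ∃ x, ord x = i + 1 := ⟨x, hx⟩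
    have : hi.choose = x := h.1.injOn trivial trivial (hi.choose_spec.trans hx.symm)
    simp only [g, dif_pos hi, this]
  have hg0 : ∀ i, 0 ≤ g i := fun i => by
    simp only [g]
    split_ifs
    · exact hr _
    · exact le_rfl
  have hanti : Antitone g := fun i j hij => by
    by_cases hj : ∃ x, ord x = j + 1
    · obtain ⟨x, hx⟩ := hj
      obtain ⟨x', hx'⟩ := hsurj i (hij.trans_lt (hlt x j hx))
      rw [hg x j hx, hg x' i hx']
      exact h.apply_le_apply (by omega)
    · have : g j = 0 := dif_neg hj
      rw [this]
      exact hg0 i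
  obtain ⟨x₀, hx₀⟩ := hsurj 0 Fintype.card_pos
  refine ⟨x₀, ?_⟩
  have key : ∑ x, (if Odd (ord x) then r x else -r x) =
      ∑ i ∈ Finset.range (Fintype.card α), (-1) ^ i * g i := by
    have := h.sum_comp (fun i => (-1) ^ (i - 1) * g (i - 1))
    simp only [Nat.add_sub_cancel] at this
    rw [← this]
    refine Finset.sum_congr rfl fun x _ => ?_
    obtain ⟨i, hi⟩ : ∃ i, ord x = i + 1 := by
      have := (h.1.mapsTo (Set.mem_univ x)).1
      exact ⟨ord x - 1, by omega⟩
    rw [hi, Nat.add_sub_cancel, hg x i hi]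
    rcases Nat.even_or_odd i with he | ho
    · simp [he.add_one, he.neg_one_pow]
    · simp [Nat.not_odd_iff_even.2 ho.add_one, ho.neg_one_pow]
  rw [key, ← hg x₀ 0 hx₀]
  exact alternating_sum_mem_Icc _ g hanti hg0

end OrderFunctions

/-! ### Arikan's bounds on the guessing time -/

section GuessingBounds

variable {α β : Type*} [Fintype α] [LinearOrder α] [Fintype β]

/-- The rank of x counts symbols x' at least as likely as x, and for each of them J x y ≤ √(J x y)
√(J x' y). -/
theorem condGuessingTime_le {J : α → β → ℝ} (hJ : ∀ x y, 0 ≤ J x y) :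
    condGuessingTime J ≤ ∑ y, (∑ x, √(J x y)) ^ 2 := by
  classical
  refine Finset.sum_le_sum fun y _ => ?_
  rw [sq, Finset.sum_mul]
  refine Finset.sum_le_sum fun x _ => ?_
  rcases (hJ x y).eq_or_lt with h0 | hpos
  · simp [← h0]
  have hsum : 0 < ∑ x', J x' y :=
    Finset.sum_pos' (fun x' _ => hJ x' y) ⟨x, Finset.mem_univ x, hpos⟩
  rw [orderIndex, Finset.mul_sum, mul_comm, ← nsmul_eq_mul, ← Finset.sum_const]
  refine (Finset.sum_le_sum fun x' hx' => ?_).trans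
    (Finset.sum_le_univ_sum_of_nonneg fun x' => by positivity)
  have hle : J x y ≤ J x' y := by
    have h2 : conditional J y x ≤ conditional J y x' := by
      rcases (Finset.mem_filter.1 hx').2 with h | h
      · exact h.le
      · exact h.1.ge
    exact (div_le_div_iff_of_pos_right hsum).1 h2
  calc J x y = √(J x y) * √(J x y) := (Real.mul_self_sqrt (hJ x y)).symm
    _ ≤ _ := by gcongr

/-- Cauchy–Schwarz for √J = √(J · ord) · √(1/ord); the reciprocals of the ranks sum to a harmonic
number. -/
theorem sum_sq_le_condGuessingTime {J : α → β → ℝ} (hJ : ∀ x y, 0 ≤ J x y) :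
    ∑ y, (∑ x, √(J x y)) ^ 2 ≤
      condGuessingTime J * (1 + Real.log (Fintype.card α)) := by
  rw [condGuessingTime, Finset.sum_mul]
  refine Finset.sum_le_sum fun y _ => ?_
  have ho := isOrderFunction_orderIndex (conditional J y)
  have hpos : ∀ x, (0 : ℝ) < orderIndex (conditional J y) x := fun x => by
    exact_mod_cast (ho.1.mapsTo (Set.mem_univ x)).1
  have hH : ∑ x, ((orderIndex (conditional J y) x : ℝ))⁻¹ ≤ 1 + Real.log (Fintype.card α) := by
    rw [ho.sum_comp (fun i => (i : ℝ)⁻¹)]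
    have := harmonic_le_one_add_log (Fintype.card α)
    simpa [harmonic] using this
  refine (Finset.sum_sq_le_sum_mul_sum_of_sq_le_mul Finset.univ
    (f := fun x => J x y * orderIndex (conditional J y) x)
    (g := fun x => ((orderIndex (conditional J y) x : ℝ))⁻¹)
    (fun x _ => mul_nonneg (hJ x y) (hpos x).le) (fun x _ => (inv_pos.2 (hpos x)).le)
    (fun x _ => le_of_eq ?_)).trans
    (mul_le_mul_of_nonneg_left hH
      (Finset.sum_nonneg fun x _ => mul_nonneg (hJ x y) (hpos x).le))
  rw [Real.sq_sqrt (hJ x y), mul_assoc, mul_inv_cancel₀ (hpos x).ne', mul_one]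

theorem sum_le_condGuessingTime {J : α → β → ℝ} (hJ : ∀ x y, 0 ≤ J x y) :
    ∑ y, ∑ x, J x y ≤ condGuessingTime J := by
  refine Finset.sum_le_sum fun y _ => Finset.sum_le_sum fun x _ => ?_
  have h1 : (1 : ℝ) ≤ orderIndex (conditional J y) x := by
    exact_mod_cast ((isOrderFunction_orderIndex (conditional J y)).1.mapsTo (Set.mem_univ x)).1
  exact le_mul_of_one_le_right (hJ x y) h1

end GuessingBounds

/-! ### Evolution of `renyiSum` over channel uses -/

section FeedbackRecursion

variable {p : ℝ} {M : ℕ}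

theorem bsc_nonneg (hp0 : 0 ≤ p) (hp1 : p ≤ 1) (x y : Bool) : 0 ≤ bsc p x y := by
  unfold bsc; split_ifs <;> linarith

theorem jointLaw_nonneg (hp0 : 0 ≤ p) (hp1 : p ≤ 1) (enc : FeedbackEncoder M) (n : ℕ) (w : Fin M)
    (y : Fin n → Bool) : 0 ≤ jointLaw p enc n w y :=
  mul_nonneg (by positivity) (Finset.prod_nonneg fun _ _ => bsc_nonneg hp0 hp1 _ _)

theorem jointLaw_snoc (enc : FeedbackEncoder M) (n : ℕ) (w : Fin M) (y : Fin n → Bool) (b : Bool) :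
    jointLaw p enc (n + 1) w (Fin.snoc (α := fun _ => Bool) y b) =
      jointLaw p enc n w y * bsc p (enc n y w) b := by
  have hlast : (fun i : Fin n => (Fin.snoc (α := fun _ => Bool) y b : Fin (n + 1) → Bool)
      (Fin.castLE (Fin.last n).isLt.le i)) = y := by
    funext i
    exact Fin.snoc_castSucc (α := fun _ => Bool) b y i
  have hinit : ∀ k : Fin n, (fun i : Fin k => (Fin.snoc (α := fun _ => Bool) y b :
      Fin (n + 1) → Bool) (Fin.castLE k.castSucc.isLt.le i)) =
      fun i : Fin k => y (Fin.castLE k.isLt.le i) := by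
    intro k
    funext i
    exact Fin.snoc_castSucc (α := fun _ => Bool) b y (Fin.castLE k.isLt.le i)
  simp only [jointLaw, likelihood]
  rw [Fin.prod_univ_castSucc, ← mul_assoc]
  congr 1
  · congr 1
    refine Finset.prod_congr rfl fun k _ => ?_
    rw [Fin.snoc_castSucc]
    exact congrArg (fun z => bsc p (enc k z w) (y k)) (hinit k)
  · rw [Fin.snoc_last]
    exact congrArg (fun z => bsc p (enc n z w) b) hlast

theorem sum_snoc (n : ℕ) (f : (Fin (n + 1) → Bool) → ℝ) :
    ∑ y, f y = ∑ y : Fin n → Bool, (f (Fin.snoc (α := fun _ => Bool) y true) +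
      f (Fin.snoc (α := fun _ => Bool) y false)) := by
  rw [← (Fin.snocEquiv fun _ : Fin (n + 1) => Bool).sum_comp, Fintype.sum_prod_type_right]
  refine Finset.sum_congr rfl fun y _ => ?_
  rw [Fintype.sum_bool]
  rfl

theorem sum_jointLaw [NeZero M] (enc : FeedbackEncoder M) (n : ℕ) :
    ∑ y, ∑ w, jointLaw p enc n w y = 1 := by
  induction n with
  | zero => simp [jointLaw, likelihood, NeZero.ne M]
  | succ n ih =>
    rw [sum_snoc, ← ih]
    refine Finset.sum_congr rfl fun y _ => ?_
    rw [← Finset.sum_add_distrib]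
    refine Finset.sum_congr rfl fun w _ => ?_
    rw [jointLaw_snoc, jointLaw_snoc, ← mul_add]
    cases enc n y w <;> simp [bsc]

/-- The sum `Σ_y (Σ_w √P(w, y))²`, which is within a factor `1 + log M` of the guessing time. -/
noncomputable def renyiSum (p : ℝ) {M : ℕ} (enc : FeedbackEncoder M) (n : ℕ) : ℝ :=
  ∑ y, (∑ w, √(jointLaw p enc n w y)) ^ 2

/-- The factor `2 ^ (h_{1/2}(p) - 1)` by which one channel use reduces `renyiSum` at best. -/
noncomputable def renyiFactor (p : ℝ) : ℝ := (√p + √(1 - p)) ^ 2 / 2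

theorem renyiSum_zero [NeZero M] (enc : FeedbackEncoder M) : renyiSum p enc 0 = M := by
  have hM : (0 : ℝ) < M := by exact_mod_cast Nat.pos_of_ne_zero (NeZero.ne M)
  simp [renyiSum, jointLaw, likelihood, mul_pow, inv_pow, Real.sq_sqrt hM.le]
  field_simp

/-- One channel use changes `renyiSum` according to the imbalance of the partition. -/
theorem renyiSum_succ (hp0 : 0 ≤ p) (hp1 : p ≤ 1) (enc : FeedbackEncoder M) (n : ℕ) :
    renyiSum p enc (n + 1) = ∑ y, (renyiFactor p * (∑ w, √(jointLaw p enc n w y)) ^ 2 +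
      (1 - renyiFactor p) * (∑ w, if enc n y w = true then √(jointLaw p enc n w y)
        else -√(jointLaw p enc n w y)) ^ 2) := by
  rw [renyiSum, sum_snoc]
  refine Finset.sum_congr rfl fun y _ => ?_
  set r : Fin M → ℝ := fun w => √(jointLaw p enc n w y)
  set a : ℝ := ∑ w, if enc n y w = true then r w else 0 with ha
  set b : ℝ := ∑ w, if enc n y w = true then 0 else r w with hb
  have hq : 0 ≤ 1 - p := by linarith
  have h1 : ∑ w, √(jointLaw p enc (n + 1) w (Fin.snoc (α := fun _ => Bool) y true)) =
      √(1 - p) * a + √p * b := by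
    rw [ha, hb, Finset.mul_sum, Finset.mul_sum, ← Finset.sum_add_distrib]
    refine Finset.sum_congr rfl fun w _ => ?_
    rw [jointLaw_snoc, Real.sqrt_mul (jointLaw_nonneg hp0 hp1 enc n w y)]
    cases enc n y w <;> simp [bsc, r, mul_comm]
  have h2 : ∑ w, √(jointLaw p enc (n + 1) w (Fin.snoc (α := fun _ => Bool) y false)) =
      √p * a + √(1 - p) * b := by
    rw [ha, hb, Finset.mul_sum, Finset.mul_sum, ← Finset.sum_add_distrib]
    refine Finset.sum_congr rfl fun w _ => ?_
    rw [jointLaw_snoc, Real.sqrt_mul (jointLaw_nonneg hp0 hp1 enc n w y)]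
    cases enc n y w <;> simp [bsc, r, mul_comm]
  have h3 : ∑ w, r w = a + b := by
    rw [ha, hb, ← Finset.sum_add_distrib]
    refine Finset.sum_congr rfl fun w _ => ?_
    split_ifs <;> simp
  have h4 : (∑ w, if enc n y w = true then r w else -r w) = a - b := by
    rw [ha, hb, ← Finset.sum_sub_distrib]
    refine Finset.sum_congr rfl fun w _ => ?_
    split_ifs <;> simp
  have e1 := Real.sq_sqrt hp0
  have e2 := Real.sq_sqrt hq
  -- The two sides agree once √p² + √(1-p)² = 1; their difference is a multiple of (a-b)².
  rw [h1, h2, h3, h4, renyiFactor]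
  linear_combination (a - b) ^ 2 * (e1 + e2)

theorem renyiFactor_le_one (hp0 : 0 ≤ p) (hp1 : p ≤ 1) : renyiFactor p ≤ 1 := by
  have e1 := Real.sq_sqrt hp0
  have e2 := Real.sq_sqrt (sub_nonneg.2 hp1)
  unfold renyiFactor
  nlinarith [sq_nonneg (√p - √(1 - p))]

theorem renyiFactor_pos (hp : p < 1) : 0 < renyiFactor p := by
  have := Real.sqrt_pos.2 (sub_pos.2 hp)
  unfold renyiFactor
  positivity

theorem renyiFactor_eq_rpow (hp : p < 1) :
    renyiFactor p = (2 : ℝ) ^ (-(1 - renyiHalf p)) := by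
  have := Real.sqrt_pos.2 (sub_pos.2 hp)
  have hs : 0 < √p + √(1 - p) := by positivity
  rw [neg_sub, Real.rpow_sub two_pos, renyiHalf, mul_comm, Real.rpow_mul two_pos.le,
    Real.rpow_logb two_pos (by norm_num) hs, renyiFactor]
  norm_num

theorem le_renyiSum [NeZero M] (hp0 : 0 ≤ p) (hp : p < 1) (enc : FeedbackEncoder M) (n : ℕ) :
    renyiFactor p ^ n * M ≤ renyiSum p enc n := by
  induction n with
  | zero => simp [renyiSum_zero]
  | succ n ih =>
    rw [renyiSum_succ hp0 hp.le, pow_succ', mul_assoc]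
    refine (mul_le_mul_of_nonneg_left ih (renyiFactor_pos hp).le).trans ?_
    rw [renyiSum, Finset.mul_sum]
    refine Finset.sum_le_sum fun y _ => le_add_of_nonneg_right ?_
    exact mul_nonneg (sub_nonneg.2 (renyiFactor_le_one hp0 hp.le)) (sq_nonneg _)

/-- Normalization and square roots preserve the order, so the partition is also zigzag for the
weights √J, and its imbalance is at most the largest of them. -/
theorem IsZigzagPartition.sq_diff_le [NeZero M] {J : Fin M → ℝ} (hJ : ∀ w, 0 ≤ J w)
    {x : Fin M → Bool}
    (h : IsZigzagPartition (fun w => J w / ∑ w', J w') {w | x w = true}) :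
    (∑ w, if x w = true then √(J w) else -√(J w)) ^ 2 ≤ ∑ w, J w := by
  rcases (Finset.sum_nonneg fun w _ => hJ w : 0 ≤ ∑ w, J w).eq_or_lt with h0 | hpos
  · have hz : ∀ w, J w = 0 := fun w =>
      (Finset.sum_eq_zero_iff_of_nonneg fun w _ => hJ w).1 h0.symm w (Finset.mem_univ w)
    simp [hz]
  · obtain ⟨ord, hord, hA⟩ := h
    obtain ⟨x₀, hx₀⟩ := ((hord.of_div hpos).sqrt hJ).exists_zigzag_diff
      (fun w => Real.sqrt_nonneg _)
    have hodd : ∀ w, (x w = true ↔ Odd (ord w)) := fun w => Set.ext_iff.1 hA w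
    simp only [hodd]
    refine (pow_le_pow_left₀ hx₀.1 hx₀.2 2).trans ?_
    rw [Real.sq_sqrt (hJ x₀)]
    exact Finset.single_le_sum (fun w _ => hJ w) (Finset.mem_univ x₀)

/-- The affine recursion S ↦ ρS + (1-ρ) has fixed point 1, which is the additive term. -/
theorem renyiSum_le [NeZero M] (hp0 : 0 ≤ p) (hp : p < 1) (enc : FeedbackEncoder M) (n : ℕ)
    (h : IsZigzagScheme p enc n) : renyiSum p enc n ≤ renyiFactor p ^ n * M + 1 := by
  induction n with
  | zero => simp [renyiSum_zero]
  | succ n ih =>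
    have ih := ih fun k hk => h k (hk.trans n.lt_succ_self)
    have hl := sub_nonneg.2 (renyiFactor_le_one hp0 hp.le)
    have hstep : renyiSum p enc (n + 1) ≤
        renyiFactor p * renyiSum p enc n + (1 - renyiFactor p) := by
      rw [renyiSum_succ hp0 hp.le, Finset.sum_add_distrib, ← Finset.mul_sum, ← Finset.mul_sum,
        renyiSum]
      refine add_le_add_right (mul_le_of_le_one_right hl ?_) _
      rw [← sum_jointLaw (p := p) enc n]
      refine Finset.sum_le_sum fun y _ => ?_
      exact IsZigzagPartition.sq_diff_le (fun w => jointLaw_nonneg hp0 hp.le enc n w y)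
        (h n n.lt_succ_self y)
    have := mul_le_mul_of_nonneg_left ih (renyiFactor_pos hp).le
    rw [pow_succ']
    linarith

end FeedbackRecursion

/-! ### Achievability, converse and the cutoff rate -/

section Rates

variable {p R : ℝ}

instance (R : ℝ) (n : ℕ) : NeZero (numMessages R n) :=
  ⟨(Nat.ceil_pos.2 (by positivity)).ne'⟩

theorem renyiFactor_pow_mul (hp : p < 1) (n : ℕ) :
    renyiFactor p ^ n * (2 : ℝ) ^ ((n : ℝ) * R) =
      (2 : ℝ) ^ ((n : ℝ) * (R - (1 - renyiHalf p))) := by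
  rw [renyiFactor_eq_rpow hp, ← Real.rpow_natCast, ← Real.rpow_mul two_pos.le,
    ← Real.rpow_add two_pos]
  congr 1
  ring

/-- Below the cutoff rate the guessing time of the repeated zigzag scheme is even bounded. -/
theorem zigzag_guessingTime_le (hp0 : 0 ≤ p) (hp : p < 1) (hR : R < 1 - renyiHalf p) (n : ℕ)
    (enc : FeedbackEncoder (numMessages R n)) (h : IsZigzagScheme p enc n) :
    messageGuessingTime p enc n ≤ 3 := by
  have h1 : messageGuessingTime p enc n ≤ renyiSum p enc n :=
    condGuessingTime_le fun w y => jointLaw_nonneg hp0 hp.le enc n w y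
  have h2 := renyiSum_le hp0 hp enc n h
  have hM : (numMessages R n : ℝ) ≤ (2 : ℝ) ^ ((n : ℝ) * R) + 1 :=
    (Nat.ceil_lt_add_one (by positivity)).le
  have h3 := mul_le_mul_of_nonneg_left hM (pow_nonneg (renyiFactor_pos hp).le n)
  rw [mul_add, renyiFactor_pow_mul hp] at h3
  have h4 : (2 : ℝ) ^ ((n : ℝ) * (R - (1 - renyiHalf p))) ≤ 1 :=
    Real.rpow_le_one_of_one_le_of_nonpos one_le_two
      (mul_nonpos_of_nonneg_of_nonpos n.cast_nonneg (by linarith))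
  have h5 : renyiFactor p ^ n ≤ 1 :=
    pow_le_one₀ (renyiFactor_pos hp).le (renyiFactor_le_one hp0 hp.le)
  -- The bound 3 collects 1 from 2^(nR), 1 from rounding up the number of messages, and the additive
  -- 1 of `renyiSum_le`.
  linarith

theorem one_le_messageGuessingTime (hp0 : 0 ≤ p) (hp : p < 1) {M : ℕ} [NeZero M]
    (enc : FeedbackEncoder M) (n : ℕ) : 1 ≤ messageGuessingTime p enc n := by
  rw [← sum_jointLaw (p := p) enc n]
  exact sum_le_condGuessingTime fun w y => jointLaw_nonneg hp0 hp.le enc n w y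

theorem mem_subexponentialRates (hp0 : 0 ≤ p) (hp : p < 1) (hR : R < 1 - renyiHalf p) :
    R ∈ subexponentialRates p := by
  choose enc henc using fun n => exists_isZigzagScheme p (numMessages R n)
  refine ⟨enc, squeeze_zero (fun n => ?_) (fun n => ?_)
    (tendsto_const_div_atTop_nhds_zero_nat (Real.logb 2 3))⟩
  · exact div_nonneg (Real.logb_nonneg one_lt_two (one_le_messageGuessingTime hp0 hp _ _))
      n.cast_nonneg
  · refine div_le_div_of_nonneg_right ?_ n.cast_nonneg
    exact Real.logb_le_logb_of_le one_lt_two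
      (one_pos.trans_le (one_le_messageGuessingTime hp0 hp _ _))
      (zigzag_guessingTime_le hp0 hp hR n _ (henc n n))

theorem renyiHalf_le_one (hp0 : 0 ≤ p) (hp : p < 1) : renyiHalf p ≤ 1 := by
  have h := renyiFactor_le_one hp0 hp.le
  rw [renyiFactor_eq_rpow hp, Real.rpow_le_one_iff_of_pos two_pos] at h
  rcases h with h | h
  · linarith [h.2]
  · linarith [h.1]

theorem log_numMessages_le (hR : 0 ≤ R) (n : ℕ) :
    Real.log (numMessages R n) ≤ (n : ℝ) * R + 1 := by
  have hM : (numMessages R n : ℝ) ≤ (2 : ℝ) ^ ((n : ℝ) * R) + 1 :=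
    (Nat.ceil_lt_add_one (by positivity)).le
  have h1 : (1 : ℝ) ≤ 2 ^ ((n : ℝ) * R) := Real.one_le_rpow one_le_two (by positivity)
  have hpos : (0 : ℝ) < numMessages R n := by
    exact_mod_cast Nat.pos_of_ne_zero (NeZero.ne (numMessages R n))
  have h2 : (numMessages R n : ℝ) ≤ 2 ^ ((n : ℝ) * R + 1) := by
    rw [Real.rpow_add two_pos, Real.rpow_one]
    linarith
  refine (Real.log_le_log hpos h2).trans ?_
  rw [Real.log_rpow two_pos]
  exact mul_le_of_le_one_right (by positivity) (Real.log_two_lt_d9.le.trans (by norm_num))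

theorem le_of_mem_subexponentialRates (hp0 : 0 ≤ p) (hp : p < 1) (h : R ∈ subexponentialRates p) :
    R ≤ 1 - renyiHalf p := by
  by_contra! hlt
  have hR : 0 ≤ R := by linarith [renyiHalf_le_one hp0 hp]
  obtain ⟨enc, henc⟩ := h
  -- With half the excess rate, 2^(2εn) ≤ S_n while eventually S_n ≤ 2^(εn)(nR + 2), so an
  -- exponential would stay below a linear function.
  set ε : ℝ := (R - (1 - renyiHalf p)) / 2 with hε
  have hεpos : 0 < ε := by rw [hε]; linarith
  have hbound : ∀ᶠ n : ℕ in atTop, ((2 : ℝ) ^ ε) ^ n ≤ n * R + 2 := by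
    filter_upwards [henc.eventually_lt_const hεpos, eventually_gt_atTop 0] with n hn hn0
    have hn0' : (0 : ℝ) < n := by exact_mod_cast hn0
    have hG1 := one_le_messageGuessingTime hp0 hp (enc n) n
    have hG : messageGuessingTime p (enc n) n ≤ 2 ^ (ε * n) :=
      (Real.logb_le_iff_le_rpow one_lt_two (one_pos.trans_le hG1)).1
        ((div_lt_iff₀ hn0').1 hn).le
    have h1 : renyiSum p (enc n) n ≤ messageGuessingTime p (enc n) n *
        (1 + Real.log (Fintype.card (Fin (numMessages R n)))) :=
      sum_sq_le_condGuessingTime fun w y => jointLaw_nonneg hp0 hp.le (enc n) n w y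
    rw [Fintype.card_fin] at h1
    have h2 := (le_renyiSum hp0 hp (enc n) n).trans h1
    have h3 := mul_le_mul_of_nonneg_left
      (Nat.le_ceil ((2 : ℝ) ^ ((n : ℝ) * R))) (pow_nonneg (renyiFactor_pos hp).le n)
    rw [renyiFactor_pow_mul hp] at h3
    have h4 : 1 + Real.log (numMessages R n) ≤ n * R + 2 := by
      linarith [log_numMessages_le hR n]
    have h5 : messageGuessingTime p (enc n) n * (1 + Real.log (numMessages R n)) ≤
        2 ^ (ε * n) * (n * R + 2) :=
      (mul_le_mul_of_nonneg_left h4 (by linarith)).trans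
        (mul_le_mul_of_nonneg_right hG (by positivity))
    have h6 : (2 : ℝ) ^ ((n : ℝ) * (R - (1 - renyiHalf p))) = 2 ^ (ε * n) * 2 ^ (ε * n) := by
      rw [← Real.rpow_add two_pos]
      congr 1
      rw [hε]
      ring
    rw [h6] at h3
    have h7 := le_of_mul_le_mul_left ((h3.trans h2).trans h5) (Real.rpow_pos_of_pos two_pos _)
    rwa [Real.rpow_mul two_pos.le, Real.rpow_natCast] at h7
  have hbase : 1 < (2 : ℝ) ^ ε := Real.one_lt_rpow one_lt_two hεpos
  have hlin : Tendsto (fun n : ℕ => ((n : ℝ) * R + 2) / ((2 : ℝ) ^ ε) ^ n) atTop (𝓝 0) := by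
    have h1 := (tendsto_pow_const_div_const_pow_of_one_lt 1 hbase).const_mul R
    have h2 := (tendsto_pow_const_div_const_pow_of_one_lt 0 hbase).const_mul 2
    have h3 := h1.add h2
    simp only [mul_zero, add_zero] at h3
    refine h3.congr fun n => ?_
    ring
  obtain ⟨n, hn1, hn2⟩ := (hbound.and (hlin.eventually_lt_const one_pos)).exists
  rw [div_lt_one (by positivity)] at hn2
  linarith

theorem isLUB_subexponentialRates (hp0 : 0 ≤ p) (hp : p < 1) :
    IsLUB (subexponentialRates p) (1 - renyiHalf p) := by
  refine ⟨fun R hR => le_of_mem_subexponentialRates hp0 hp hR, fun b hb => ?_⟩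
  exact le_of_forall_lt fun c hc => by
    obtain ⟨d, hcd, hd⟩ := exists_between hc
    exact hcd.trans_le (hb (mem_subexponentialRates hp0 hp hd))

theorem cutoffRateFb_eq (hp0 : 0 ≤ p) (hp : p < 1) : cutoffRateFb p = 1 - renyiHalf p :=
  (isLUB_subexponentialRates hp0 hp).csSup_eq
    ⟨_, mem_subexponentialRates hp0 hp (sub_one_lt (1 - renyiHalf p))⟩

end Rates

end ZigzagGuessing

theorem mainTheorem7 (p : ℝ) (hp0 : 0 ≤ p) (hp : p ≤ 1 / 2) :
    (∀ R : ℝ, R < ZigzagGuessing.cutoffRateFb p →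
      ∃ C : ℝ, ∀ n : ℕ, 1 ≤ n →
        ∀ enc : ZigzagGuessing.FeedbackEncoder (ZigzagGuessing.numMessages R n),
          ZigzagGuessing.IsZigzagScheme p enc n →
            ZigzagGuessing.messageGuessingTime p enc n ≤ C * (n : ℝ) ^ 2) ∧
    IsLUB (ZigzagGuessing.subexponentialRates p) (ZigzagGuessing.cutoffRateFb p) ∧
    ZigzagGuessing.cutoffRateFb p = 1 - ZigzagGuessing.renyiHalf p := by
  have hp1 : p < 1 := by linarith
  have hcut := ZigzagGuessing.cutoffRateFb_eq hp0 hp1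
  refine ⟨fun R hR => ⟨3, fun n hn enc henc => ?_⟩, ?_, hcut⟩
  · rw [hcut] at hR
    have h1 : (1 : ℝ) ≤ n := by exact_mod_cast hn
    have h2 : (1 : ℝ) ≤ (n : ℝ) ^ 2 := one_le_pow₀ h1
    linarith [ZigzagGuessing.zigzag_guessingTime_le hp0 hp1 hR n enc henc]
  · rw [hcut]
    exact ZigzagGuessing.isLUB_subexponentialRates hp0 hp1
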